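/- Let $N\ge 2$ and $h>N$ be integers. Let $\Lambda_1,\dots,\Lambda_{N-1}$ be the fundamental weights of $SL(N)$, let $$P_{++}^{(h)}=\{\lambda=\lambda_1\Lambda_1+\dots+\lambda_{N-1}\Lambda_{N-1} : \lambda_i\in\mathbb Z,\ \lambda_i\ge 1,\ \lambda_1+\dots+\lambda_{N-1}<h\},$$ and let $e_1,\dots,e_N$ be the weights of the standard representation, so that $\Lambda_j=e_1+\dots+e_j$ and $(e_i,e_j)=\delta_{ij}-\frac1N$. For $\lambda\in P_{++}^{(h)}$ put $\epsilon_j(\lambda)=\exp\bigl(-\frac{2\pi i}{h}(e_j,\lambda)\bigr)$, $M(\lambda)=\mathrm{diag}(\epsilon_1(\lambda),\dots,\epsilon_N(\lambda))$, and $\gamma_p^{(\lambda)}=\chi_p(M(\lambda))$, where $\chi_p$ is the character of the $p$-th fundamental representation $\bigwedge^p\mathbb C^N$. A Zuber class II graph for $SL(N)$ at level $h-N$ consists of a finite vertex set $\mathcal V$ with an involution $a\mapsto\bar a$, a grading $\tau:\mathcal V\to\mathbb Z/N$ with $\tau(\bar a)=-\tau(a)$, and commuting $\mathcal V\times\mathcal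 V$ matrices $G_1,\dots,G_{N-1}$ with non-negative integer entries such that: - the graph with adjacency matrix $G_1$ is connected; - $(G_p)_{ab}=0$ whenever $\tau(b)\ne\tau(a)+p$; - $G_p^{t}=G_{N-p}$ and $(G_p)_{ab}=(G_p)_{\bar b\bar a}$; - the $G_p$ have a common orthonormal eigenbasis $\psi^{(\lambda,i)}$ of $\mathbb C^{\mathcal V}$, labelled by the set $\mathrm{Exp}$ of pairs $(\lambda,i)$ with $\lambda\in P_{++}^{(h)}$ and $1\le i\le m_\lambda$, with $G_p\psi^{(\lambda,i)}=\gamma_p^{(\lambda)}\psi^{(\lambda,i)}$ for all $p$, where $m_\lambda\ge 0$ is the multiplicity of the joint eigenvalue $(\gamma_p^{(\lambda)})_{1\le p\le N-1}$. For such a graph let $g=2I+\sum_{p=1}^{N-1}G_p$ be its intersection form, a real symmetric bilinear form, and for $\lambda\in P_{++}^{(h)}$ put $$q_\lambda^{(R)}=\frac1h\sum_{j=1}^{N-1}j(\lambda_j-1)+\frac{(N-h)(N-1)}{2h}.$$ **Corollary 1 (Zuber's Conjecture).** The signature of $g$ is $(x+,y-,z0)$, where, counting over $(\lambda,i)\in\mathrm{Exp}$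 (that is, each $\lambda$ with multiplicity $m_\lambda$), - $x$ is the number of those with $q_\lambda^{(R)}\in\,]2p-\frac12,2p+\frac12[$ for some $p\in\mathbb Z$; - $y$ is the number of those with $q_\lambda^{(R)}\in\,]2p+\frac12,2p+\frac32[$ for some $p\in\mathbb Z$; - $z$ is the number of those with $q_\lambda^{(R)}\in\mathbb Z+\frac12$. -/

import Mathlib

open scoped BigOperators Matrix

namespace Zuber

/-- `P_{++}^{(h)}`: the weights `l₁Λ₁ + ... + l_{N-1}Λ_{N-1}` of `SL(N)` with positive integral
coordinates and `l₁ + ... + l_{N-1} < h`. The coordinate `l_j` is stored at index `j - 1`. -/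
def Weight (N h : ℕ) : Type :=
  {l : Fin (N - 1) → ℕ // (∀ j, 0 < l j) ∧ ∑ j, l j < h}

instance Weight.instFinite (N h : ℕ) : Finite (Weight N h) := by
  have hlt : ∀ (l : Weight N h) (j : Fin (N - 1)), l.1 j < h := fun l j =>
    lt_of_le_of_lt (Finset.single_le_sum (fun _ _ => Nat.zero_le _) (Finset.mem_univ j)) l.2.2
  refine Finite.of_injective
    (fun (l : Weight N h) (j : Fin (N - 1)) => (⟨l.1 j, hlt l j⟩ : Fin h)) ?_
  intro l m hlm
  apply Subtype.ext
  funext j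
  have := congrFun hlm j
  simpa using this

noncomputable instance Weight.instFintype (N h : ℕ) : Fintype (Weight N h) :=
  Fintype.ofFinite _

/-- The scalar product `(e_i, e_k) = δ_{ik} - 1/N` of the weights `e_1, ..., e_N` of the
standard representation of `SL(N)` (with indices shifted to start at `0`). -/
noncomputable def stdInner {N : ℕ} (i k : Fin N) : ℝ :=
  (if i = k then 1 else 0) - 1 / (N : ℝ)

/-- The scalar product `(e_i, Λ_{j+1})`, where `Λ_{j+1} = e_1 + ... + e_{j+1}` is a
fundamental weight. -/
noncomputable def fundInner {N : ℕ} (i : Fin N) (j : Fin (N - 1)) : ℝ :=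
  ∑ k : Fin N with k.val ≤ j.val, stdInner i k

/-- The scalar product `(e_i, l)` for a weight `l`. -/
noncomputable def pairing {N h : ℕ} (i : Fin N) (l : Weight N h) : ℝ :=
  ∑ j, (l.1 j : ℝ) * fundInner i j

/-- `ε_i(l) = exp(-(2π𝐢/h) (e_i, l))`. -/
noncomputable def eps {N h : ℕ} (l : Weight N h) (i : Fin N) : ℂ :=
  Complex.exp (-(2 * (Real.pi : ℂ) * Complex.I / (h : ℂ)) * ((pairing i l : ℝ) : ℂ))

/-- The character of the `p`-th fundamental representation `⋀^p ℂ^N`. -/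
noncomputable def fundChar {N : ℕ} (p : ℕ) (M : Matrix (Fin N) (Fin N) ℂ) : ℂ :=
  LinearMap.trace ℂ (⋀[ℂ]^p (Fin N → ℂ)) (exteriorPower.map p (Matrix.toLin' M))

/-- `γ_p^{(l)} = χ_p(M(l))` with `M(l) = diag(ε_1(l), ..., ε_N(l))`. -/
noncomputable def gammaEig {N h : ℕ} (p : ℕ) (l : Weight N h) : ℂ :=
  fundChar p (Matrix.diagonal (eps l))

/-- The operator on `ℂ^V` of a matrix with entries in `ℕ`. -/
noncomputable def op {V : Type*} [Fintype V] [DecidableEq V] (A : Matrix V V ℕ) :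
    Module.End ℂ (EuclideanSpace ℂ V) :=
  Matrix.toEuclideanLin (A.map (Nat.cast : ℕ → ℂ))

/-- `m_l`: the dimension of the common eigenspace of `G_1, ..., G_{N-1}` on which each `G_p`
acts by `γ_p^{(l)}`. -/
noncomputable def mult {N h : ℕ} {V : Type*} [Fintype V] [DecidableEq V]
    (G : ℕ → Matrix V V ℕ) (l : Weight N h) : ℕ :=
  Module.finrank ℂ
    (⨅ p ∈ Finset.Ico 1 N, Module.End.eigenspace (op (G p)) (gammaEig p l) :
      Submodule ℂ (EuclideanSpace ℂ V))

/-- The index set `Exp` of pairs `(l, i)`, where `i` runs over `m_l` values. -/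
abbrev Exponents (N h : ℕ) {V : Type*} [Fintype V] [DecidableEq V]
    (G : ℕ → Matrix V V ℕ) : Type :=
  Σ l : Weight N h, Fin (mult G l)

/-- Class II graphs for `SL(N)` at level `h - N`, with vertex set `V`. Only the matrices
`G p` with `1 ≤ p ≤ N - 1` are meaningful. -/
structure ClassIIGraph (N h : ℕ) (V : Type*) [Fintype V] [DecidableEq V] where
  /-- the involution `a ↦ ā` -/
  bar : V → V
  /-- the `ℤ/N`-grading -/
  tau : V → ZMod N
  /-- the adjacency matrices `G_1, ..., G_{N-1}` -/
  G : ℕ → Matrix V V ℕ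
  bar_involutive : Function.Involutive bar
  tau_bar : ∀ a, tau (bar a) = -tau a
  commute : ∀ p ∈ Finset.Ico 1 N, ∀ q ∈ Finset.Ico 1 N, G p * G q = G q * G p
  connected : (SimpleGraph.fromRel fun a b => G 1 a b ≠ 0).Connected
  grading : ∀ p ∈ Finset.Ico 1 N, ∀ a b, tau b ≠ tau a + (p : ZMod N) → G p a b = 0
  transpose_eq : ∀ p ∈ Finset.Ico 1 N, (G p)ᵀ = G (N - p)
  bar_symm : ∀ p ∈ Finset.Ico 1 N, ∀ a b, G p a b = G p (bar b) (bar a)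
  /-- a common orthonormal eigenbasis labelled by `Exp` -/
  exists_eigenbasis : ∃ psi : OrthonormalBasis (Exponents N h G) ℂ (EuclideanSpace ℂ V),
    ∀ e : Exponents N h G, ∀ p ∈ Finset.Ico 1 N, op (G p) (psi e) = gammaEig p e.1 • psi e

namespace ClassIIGraph

variable {N h : ℕ} {V : Type*} [Fintype V] [DecidableEq V]

/-- The index set `Exp` of the graph. -/
abbrev Exp (Γ : ClassIIGraph N h V) : Type := Exponents N h Γ.G

/-- The matrix `g_{ab} = 2δ_{ab} + ∑_{p=1}^{N-1} (G_p)_{ab}`. -/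
def gMatrix (Γ : ClassIIGraph N h V) : Matrix V V ℝ :=
  2 • (1 : Matrix V V ℝ) + ∑ p ∈ Finset.Ico 1 N, (Γ.G p).map (Nat.cast : ℕ → ℝ)

theorem gMatrix_isSymm (Γ : ClassIIGraph N h V) : Γ.gMatrix.IsSymm := by
  have key : (∑ p ∈ Finset.Ico 1 N, (Γ.G p).map (Nat.cast : ℕ → ℝ))ᵀ
      = ∑ p ∈ Finset.Ico 1 N, (Γ.G p).map (Nat.cast : ℕ → ℝ) := by
    rw [Matrix.transpose_sum]
    refine Finset.sum_nbij' (fun p => N - p) (fun p => N - p) ?_ ?_ ?_ ?_ ?_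
    · intro p hp; simp only [Finset.mem_Ico] at hp ⊢; omega
    · intro p hp; simp only [Finset.mem_Ico] at hp ⊢; omega
    · intro p hp; simp only [Finset.mem_Ico] at hp; omega
    · intro p hp; simp only [Finset.mem_Ico] at hp; omega
    · intro p hp
      rw [← Γ.transpose_eq p hp, Matrix.transpose_map]
  unfold gMatrix Matrix.IsSymm
  rw [Matrix.transpose_add, key, Matrix.transpose_smul, Matrix.transpose_one]

/-- The intersection form `⟨α_a, α_b⟩ = g_{ab}` on the space with basis `(α_a)`, a symmetric
bilinear form. -/
noncomputable def intersectionForm (Γ : ClassIIGraph N h V) : LinearMap.BilinForm ℝ (V → ℝ) :=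
  Matrix.toBilin' Γ.gMatrix

end ClassIIGraph

/-- The signature of the symmetric bilinear form `B` is `(x+, y-, z0)`: `x` (resp. `y`) is the
maximal dimension of a subspace on which `B` is positive (resp. negative) definite, and `z` is
the dimension of the radical. -/
def HasSignature {E : Type*} [AddCommGroup E] [Module ℝ E]
    (B : LinearMap.BilinForm ℝ E) (x y z : ℕ) : Prop :=
  sigPos B.toQuadraticMap = x ∧ sigNeg B.toQuadraticMap = y ∧
    Module.finrank ℝ (LinearMap.ker B) = z

/-- `q_l^{(R)} = (1/h) ∑_{j=1}^{N-1} j (l_j - 1) + (N - h)(N - 1) / (2h)`. -/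
noncomputable def qR {N h : ℕ} (l : Weight N h) : ℝ :=
  1 / (h : ℝ) * ∑ j : Fin (N - 1), ((j.val : ℝ) + 1) * ((l.1 j : ℝ) - 1)
    + ((N : ℝ) - (h : ℝ)) * ((N : ℝ) - 1) / (2 * (h : ℝ))

end Zuber

open scoped BigOperators Matrix

namespace Zuber

/-! On the eigenvector labelled by `(l, i)` the form has eigenvalue `2 + ∑ γ_p`. Since `χ_0 = χ_N =
1` on `M(l)`, this is the full generating sum `∏ (1 + ε_j) = 2^N ∏ cos (π (e_j, l) / h)`, which is
real. Its sign need not be that of `cos (π q_l)` for an individual `l`; only the total counts agree.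

The agreement comes from rotating the affine labels `λ₁, ..., λ_{N-1}, λ₀`, where `λ₀ = h - ∑ λ_j`.
Rotation multiplies `γ_p` by `exp (-2πip / N)`. The diagonal operator built from the grading
realises the same twist on `G_p`, so `m_l` is constant on rotation orbits (`mult_rot`). It is
therefore enough to compare the signs over `N` successive rotates of one weight.

The rescaled coordinates of `l` form an increasing sequence `w` with `w (j + N) = w j + N`. For the
`k`-th rotate, `q` is `w k - k` (`qR_rot_iterate`), and the eigenvalue is a positive multiple of the
product of `sin (π (w j - (k + 1/2)) / N)` over one period (`sineProd_rot_iterate`). Let `n k` be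
the last index with `w j ≤ k + 1/2`. The product has sign `(-1)^(n k + k)`, and for `n (k - 1) < j ≤
n k` the sign of `cos (π (w j - j))` is `(-1)^(j + k)`; both vanish at a tie `w j = k + 1/2`. Block
by block, the sums of signs and of squared signs differ by periodic telescoping terms
(`sum_sign_eq_sum_sign`). These two moments determine how often each sign occurs. -/

/-! ### Characters of exterior powers at diagonal matrices -/

theorem fundChar_diagonal {N : ℕ} (p : ℕ) (d : Fin N → ℂ) :
    fundChar p (Matrix.diagonal d) = ∑ s ∈ Finset.powersetCard p Finset.univ, ∏ i ∈ s, d i := by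
  classical
  -- The wedges of standard basis vectors are eigenvectors, so the trace is the elementary symmetric
  -- polynomial of the diagonal entries.
  have key : ∀ s : Set.powersetCard (Fin N) p,
      exteriorPower.map p (Matrix.toLin' (Matrix.diagonal d))
        (exteriorPower.ιMulti_family ℂ p (Pi.basisFun ℂ (Fin N)) s)
      = (∏ i ∈ (s : Finset (Fin N)), d i) •
        exteriorPower.ιMulti_family ℂ p (Pi.basisFun ℂ (Fin N)) s := by
    intro s
    rw [exteriorPower.map_apply_ιMulti_family]
    have h1 : (Matrix.toLin' (Matrix.diagonal d)) ∘ Pi.basisFun ℂ (Fin N)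
        = fun i => d i • Pi.basisFun ℂ (Fin N) i := by
      funext i
      simp [← Pi.single_smul]
    rw [h1]
    change exteriorPower.ιMulti ℂ p (fun k => d (Set.powersetCard.ofFinEmbEquiv.symm s k) •
      Pi.basisFun ℂ (Fin N) (Set.powersetCard.ofFinEmbEquiv.symm s k)) = _
    rw [AlternatingMap.map_smul_univ]
    congr 1
    have hs : (s : Finset (Fin N)).card = p := s.prop
    have h2 := Finset.prod_map Finset.univ (Finset.orderEmbOfFin s.val hs).toEmbedding d
    rw [Finset.map_orderEmbOfFin_univ] at h2
    exact h2.symm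
  rw [fundChar, LinearMap.trace_eq_matrix_trace ℂ ((Pi.basisFun ℂ (Fin N)).exteriorPower p),
    Matrix.trace]
  have hd : ∀ s, (LinearMap.toMatrix ((Pi.basisFun ℂ (Fin N)).exteriorPower p)
      ((Pi.basisFun ℂ (Fin N)).exteriorPower p)
      (exteriorPower.map p (Matrix.toLin' (Matrix.diagonal d)))).diag s
      = ∏ i ∈ (s : Finset (Fin N)), d i := by
    intro s
    rw [Matrix.diag_apply, LinearMap.toMatrix_apply, exteriorPower.basis_apply, key]
    simp
  rw [Finset.sum_congr rfl fun s _ => hd s]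
  refine (Finset.sum_subtype (Finset.powersetCard p Finset.univ)
    (p := fun s => s ∈ Set.powersetCard (Fin N) p) ?_ (fun s => ∏ i ∈ s, d i)).symm
  intro s
  simp [Set.powersetCard.mem_iff]

theorem fundChar_diagonal_smul {N : ℕ} (p : ℕ) (c : ℂ) (d : Fin N → ℂ) :
    fundChar p (Matrix.diagonal (c • d)) = c ^ p * fundChar p (Matrix.diagonal d) := by
  rw [fundChar_diagonal, fundChar_diagonal, Finset.mul_sum]
  refine Finset.sum_congr rfl fun s hs => ?_
  simp [Finset.prod_mul_distrib, (Finset.mem_powersetCard.1 hs).2]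

theorem sum_fundChar_diagonal {N : ℕ} (d : Fin N → ℂ) :
    ∑ p ∈ Finset.range (N + 1), fundChar p (Matrix.diagonal d) = ∏ i, (1 + d i) := by
  simp_rw [fundChar_diagonal, Finset.prod_one_add]
  rw [Finset.sum_powerset]
  simp

theorem fundChar_zero_diagonal {N : ℕ} (d : Fin N → ℂ) :
    fundChar 0 (Matrix.diagonal d) = 1 := by
  simp [fundChar_diagonal]

theorem fundChar_top_diagonal {N : ℕ} (d : Fin N → ℂ) :
    fundChar N (Matrix.diagonal d) = ∏ i, d i := by
  rw [fundChar_diagonal]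
  have : Finset.powersetCard N (Finset.univ : Finset (Fin N)) = {Finset.univ} := by
    simpa using Finset.powersetCard_self (Finset.univ : Finset (Fin N))
  simp [this]

/-! ### Sums and products over a period -/

theorem sum_range_periodic {g : ℤ → ℝ} {N : ℕ} (hg : ∀ j, g (j + N) = g j) (a : ℤ) :
    ∑ i ∈ Finset.range N, g (a + i) = ∑ i ∈ Finset.range N, g i := by
  have step : ∀ a : ℤ, ∑ i ∈ Finset.range N, g (a + 1 + i) = ∑ i ∈ Finset.range N, g (a + i) := by
    intro a
    have h1 := Finset.sum_range_succ (fun i : ℕ => g (a + i)) N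
    have h2 := Finset.sum_range_succ' (fun i : ℕ => g (a + i)) N
    simp only [Nat.cast_add, Nat.cast_one, Nat.cast_zero, add_zero, hg] at h1 h2
    have h3 : ∑ i ∈ Finset.range N, g (a + 1 + i) = ∑ i ∈ Finset.range N, g (a + (i + 1)) :=
      Finset.sum_congr rfl fun i _ => by congr 1; ring
    linarith
  induction a with
  | zero => simp
  | succ a ih => rw [step, ih]
  | pred a ih => rw [← ih, ← step, sub_add_cancel]

theorem sum_Ioc_eq_sum_range (g : ℤ → ℝ) (a : ℤ) (M : ℕ) :
    ∑ j ∈ Finset.Ioc a (a + M), g j = ∑ i ∈ Finset.range M, g (a + 1 + i) := by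
  induction M with
  | zero => simp
  | succ M ih =>
    rw [Finset.sum_range_succ, ← ih]
    have : Finset.Ioc a (a + (M + 1 : ℕ)) = insert (a + 1 + M) (Finset.Ioc a (a + M)) := by
      ext j; simp only [Finset.mem_Ioc, Finset.mem_insert]; omega
    rw [this, Finset.sum_insert (by simp), add_comm]

/-- The blocks `(n (k - 1), n k]` tile `(n 0, n M]`, and the `E` terms cancel between neighbouring
blocks. -/
theorem sum_Ioc_telescope {n : ℤ → ℤ} (hn : Monotone n) {f g E : ℤ → ℝ}
    (h : ∀ k, ∑ j ∈ Finset.Ioc (n (k - 1)) (n k), g j = f k + E (k - 1) - E k) (M : ℕ) :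
    ∑ j ∈ Finset.Ioc (n 0) (n M), g j
      = (∑ i ∈ Finset.range M, f (1 + i)) + E 0 - E M := by
  induction M with
  | zero => simp
  | succ M ih =>
    rw [Finset.sum_range_succ,
      ← Finset.Ioc_union_Ioc_eq_Ioc (hn (Nat.cast_nonneg M)) (hn (by simp : (M : ℤ) ≤ (M + 1 : ℕ))),
      Finset.sum_union (Finset.Ioc_disjoint_Ioc_of_le le_rfl), ih]
    have := h (M + 1)
    rw [add_sub_cancel_right] at this
    push_cast
    rw [this, add_comm (1 : ℤ) M]
    ring

/-- Sums over a period of two periodic functions agree when they agree up to a telescoping term. -/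
theorem sum_range_eq_of_telescope {N : ℕ} {n : ℤ → ℤ} (hn : Monotone n)
    (hnN : ∀ k, n (k + N) = n k + N) {f g E : ℤ → ℝ} (hf : ∀ j, f (j + N) = f j)
    (hg : ∀ j, g (j + N) = g j) (hE : ∀ j, E (j + N) = E j)
    (h : ∀ k, ∑ j ∈ Finset.Ioc (n (k - 1)) (n k), g j = f k + E (k - 1) - E k) :
    ∑ i ∈ Finset.range N, f i = ∑ i ∈ Finset.range N, g i := by
  have h1 := sum_Ioc_telescope hn h N
  have h2 := hnN 0
  have h3 := hE 0
  rw [zero_add] at h2 h3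
  rw [h2, h3, sum_Ioc_eq_sum_range, sum_range_periodic hg, sum_range_periodic hf] at h1
  linarith

theorem sum_Ioc_neg_one_zpow (a : ℤ) (M : ℕ) :
    ∑ j ∈ Finset.Ioc a (a + M), 2 * (-1 : ℝ) ^ j = (-1) ^ (a + M) - (-1) ^ a := by
  rw [sum_Ioc_eq_sum_range]
  induction M with
  | zero => simp
  | succ M ih =>
    rw [Finset.sum_range_succ, ih]
    push_cast
    rw [← add_assoc, zpow_add_one₀ (by norm_num), add_right_comm, zpow_add_one₀ (by norm_num)]
    ring

/-- Moving the window one place replaces the factor `s a` by `s (a + N) = -s a`. -/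
theorem prod_range_antiperiodic {s : ℤ → ℝ} {N : ℕ} (hN : 0 < N) (hs : ∀ j, s (j + N) = -s j)
    (a : ℤ) : ∏ i ∈ Finset.range N, s (a + i) = (-1) ^ a * ∏ i ∈ Finset.range N, s i := by
  obtain ⟨M, rfl⟩ : ∃ M, N = M + 1 := ⟨N - 1, by omega⟩
  have step : ∀ a : ℤ, ∏ i ∈ Finset.range (M + 1), s (a + 1 + i)
      = -∏ i ∈ Finset.range (M + 1), s (a + i) := by
    intro a
    rw [Finset.prod_range_succ, Finset.prod_range_succ']
    have h1 : s (a + 1 + M) = -s a := by rw [← hs a]; congr 1; push_cast; ring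
    have h3 : ∏ i ∈ Finset.range M, s (a + 1 + i)
        = ∏ i ∈ Finset.range M, s (a + ((i + 1 : ℕ) : ℤ)) :=
      Finset.prod_congr rfl fun i _ => by congr 1; push_cast; ring
    rw [h1, h3]; simp
  induction a with
  | zero => simp
  | succ a ih => rw [step, ih, zpow_add_one₀ (by norm_num)]; ring
  | pred a ih =>
    have := step (-a - 1)
    rw [sub_add_cancel, ih] at this
    rw [zpow_sub_one₀ (by norm_num)]
    linarith

/-! ### Quasiperiodic sequences and half-integers -/

section

variable {N : ℕ} {w : ℤ → ℝ}

theorem apply_add_mul_of_quasiperiodic (hw : ∀ j, w (j + N) = w j + N) (j m : ℤ) :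
    w (j + m * N) = w j + m * N := by
  induction m with
  | zero => simp
  | succ m ih =>
    rw [add_one_mul, ← add_assoc, hw, ih]; push_cast; ring
  | pred m ih =>
    have := hw (j + (-m - 1) * N)
    rw [show j + (-m - 1) * N + N = j + -(m : ℤ) * N by ring, ih] at this
    push_cast at this ⊢
    linarith

/-- Quasiperiodicity makes `w` unbounded in both directions, so a last index with `w j ≤ k + 1/2`
exists. The non-strict inequality places a tie at the index `n k` itself. -/
theorem exists_floor_of_quasiperiodic (hN : 0 < N) (hmono : StrictMono w)
    (hw : ∀ j, w (j + N) = w j + N) :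
    ∃ n : ℤ → ℤ, ∀ j k : ℤ, j ≤ n k ↔ w j ≤ k + 1 / 2 := by
  have hN' : (0 : ℝ) < N := by exact_mod_cast hN
  have key : ∀ k : ℤ, ∃ b : ℤ, ∀ j : ℤ, j ≤ b ↔ w j ≤ k + 1 / 2 := by
    intro k
    obtain ⟨b, hb, hb'⟩ := Int.exists_greatest_of_bdd (P := fun j : ℤ => w j ≤ k + 1 / 2) (by
        obtain ⟨m, hm⟩ := exists_nat_gt (((k : ℝ) + 1 / 2 - w 0) / N)
        rw [div_lt_iff₀ hN'] at hm
        refine ⟨m * N, fun z hz => ?_⟩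
        have := apply_add_mul_of_quasiperiodic hw 0 m
        rw [zero_add] at this
        refine (hmono.lt_iff_lt.1 (lt_of_le_of_lt hz ?_)).le
        rw [this]; push_cast; linarith) (by
        obtain ⟨m, hm⟩ := exists_nat_gt ((w 0 - ((k : ℝ) + 1 / 2)) / N)
        rw [div_lt_iff₀ hN'] at hm
        refine ⟨-m * N, ?_⟩
        have := apply_add_mul_of_quasiperiodic hw 0 (-m)
        rw [zero_add] at this
        rw [this]; push_cast; linarith)
    exact ⟨b, fun j => ⟨fun h => (hmono.monotone h).trans hb, hb' j⟩⟩
  choose n hn using key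
  exact ⟨n, fun j k => hn k j⟩

/-- The product of the sines of the angles between the points `w j` of one period, starting at
`k + 1`, and the half-integer `k + 1 / 2`. -/
noncomputable def sineProd (N : ℕ) (w : ℤ → ℝ) (k : ℤ) : ℝ :=
  ∏ i ∈ Finset.range N, Real.sin (Real.pi * (w (k + 1 + i) - (k + 1 / 2)) / N)

theorem sineProd_add_period (hw : ∀ j, w (j + N) = w j + N) (k : ℤ) :
    sineProd N w (k + N) = sineProd N w k := by
  refine Finset.prod_congr rfl fun i _ => ?_
  rw [show k + N + 1 + i = (k + 1 + i) + N by ring, hw]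
  push_cast
  congr 3
  ring

theorem sign_neg_one_zpow_mul (m : ℤ) (x : ℝ) :
    (SignType.sign ((-1) ^ m * x) : ℝ) = (-1) ^ m * (SignType.sign x : ℝ) := by
  rcases Int.even_or_odd m with h | h
  · simp [h.neg_one_zpow]
  · simp [h.neg_one_zpow, Left.sign_neg]

/-- The sine changes sign under `j ↦ j + N`, so sliding the window to start at `n k + 1` costs a
power of `-1`. There all angles lie in `(0, π]`, and `π` is reached exactly when `w (n k)` is a tie.
-/
theorem sign_sineProd (hN : 0 < N) (hmono : StrictMono w) (hw : ∀ j, w (j + N) = w j + N)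
    {n : ℤ → ℤ} (hn : ∀ j k : ℤ, j ≤ n k ↔ w j ≤ k + 1 / 2) (k : ℤ) :
    (SignType.sign (sineProd N w k) : ℝ)
      = if w (n k) = k + 1 / 2 then 0 else (-1) ^ (n k + k) := by
  have hN' : (0 : ℝ) < N := by exact_mod_cast hN
  set s : ℤ → ℝ := fun j => Real.sin (Real.pi * (w j - (k + 1 / 2)) / N) with hs
  have hanti : ∀ j, s (j + N) = -s j := by
    intro j
    simp only [hs, hw]
    rw [← Real.sin_add_pi]
    congr 1
    field_simp
    ring
  have h1 : sineProd N w k = (-1) ^ (n k + k) * ∏ i ∈ Finset.range N, s (n k + 1 + i) := by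
    rw [prod_range_antiperiodic hN hanti (n k + 1), ← mul_assoc, ← zpow_add₀ (by norm_num)]
    change ∏ i ∈ Finset.range N, s (k + 1 + i) = _
    rw [prod_range_antiperiodic hN hanti (k + 1)]
    congr 1
    rw [show n k + k + (n k + 1) = (k + 1) + (n k + n k) by ring, zpow_add₀ (by norm_num) (k + 1),
      (Even.add_self (n k)).neg_one_zpow, mul_one]
  have hlast : w (n k + N) = w (n k) + N := hw _
  have hle : w (n k) ≤ k + 1 / 2 := (hn _ _).1 le_rfl
  have hgt : ∀ i : ℕ, k + 1 / 2 < w (n k + 1 + i) := fun i =>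
    not_le.1 fun h => by have := (hn _ _).2 h; omega
  rw [h1, sign_neg_one_zpow_mul]
  split_ifs with h
  · have : ∏ i ∈ Finset.range N, s (n k + 1 + i) = 0 := by
      -- The last factor has index `n k + N`, one period above the tie, and so angle `π`.
      refine Finset.prod_eq_zero (i := N - 1) (Finset.mem_range.2 (by omega)) ?_
      have : n k + 1 + ((N - 1 : ℕ) : ℤ) = n k + N := by omega
      simp only [hs, this, hlast, h]
      rw [add_sub_cancel_left, mul_div_cancel_right₀ _ hN'.ne', Real.sin_pi]
    simp [this]
  · have hlt := lt_of_le_of_ne hle h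
    have : 0 < ∏ i ∈ Finset.range N, s (n k + 1 + i) := by
      refine Finset.prod_pos fun i hi => ?_
      have hi' := Finset.mem_range.1 hi
      have hupper : w (n k + 1 + i) ≤ w (n k + N) := hmono.monotone (by omega)
      refine Real.sin_pos_of_pos_of_lt_pi ?_ ?_
      · have := hgt i
        have : 0 < w (n k + 1 + i) - (k + 1 / 2) := by linarith
        positivity
      · rw [div_lt_iff₀ hN']
        exact mul_lt_mul_of_pos_left (by linarith) Real.pi_pos
    simp [sign_pos this]

theorem sign_cos_pi_mul_sub {x : ℝ} {j k : ℤ} (h1 : (k : ℝ) - 1 / 2 < x) (h2 : x ≤ k + 1 / 2) :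
    (SignType.sign (Real.cos (Real.pi * (x - j))) : ℝ)
      = if x = k + 1 / 2 then 0 else (-1) ^ (j + k) := by
  have : Real.cos (Real.pi * (x - j)) = (-1) ^ (k - j) * Real.cos (Real.pi * (x - k)) := by
    rw [← Real.cos_add_int_mul_pi]
    congr 1
    push_cast
    ring
  rw [this, sign_neg_one_zpow_mul]
  split_ifs with h
  · rw [h, add_sub_cancel_left, mul_one_div, Real.cos_pi_div_two]
    simp
  · have hlt := lt_of_le_of_ne h2 h
    have hpos : 0 < Real.cos (Real.pi * (x - k)) := by
      refine Real.cos_pos_of_mem_Ioo ⟨?_, ?_⟩ <;> nlinarith [Real.pi_pos]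
    rw [sign_pos hpos, show j + k = (k - j) + (j + j) by ring, zpow_add₀ (by norm_num),
      (Even.add_self j).neg_one_zpow]
    simp

/-- The indices `j` are cut into blocks `(n (k - 1), n k]`, on which `k` is the integer nearest to
`w j`, ties rounding down. The `k`-th block is then compared with the single sign of `sineProd N w
k`. -/
theorem sum_sign_eq_sum_sign (hN : 0 < N) (hmono : StrictMono w)
    (hw : ∀ j, w (j + N) = w j + N) :
    (∑ k ∈ Finset.range N, (SignType.sign (sineProd N w k) : ℝ)
      = ∑ k ∈ Finset.range N,
        (SignType.sign (Real.cos (Real.pi * (w k - ((k : ℤ) : ℝ)))) : ℝ)) ∧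
    (∑ k ∈ Finset.range N, (SignType.sign (sineProd N w k) : ℝ) ^ 2
      = ∑ k ∈ Finset.range N,
        (SignType.sign (Real.cos (Real.pi * (w k - ((k : ℤ) : ℝ)))) : ℝ) ^ 2) := by
  obtain ⟨n, hn⟩ := exists_floor_of_quasiperiodic hN hmono hw
  have hnmono : Monotone n := by
    intro k l hkl
    have h1 := (hn (n k) k).1 le_rfl
    have : (k : ℝ) ≤ l := by exact_mod_cast hkl
    exact (hn _ _).2 (by linarith)
  have hnN : ∀ k, n (k + N) = n k + N := by
    intro k
    refine le_antisymm ?_ ?_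
    · have h1 := (hn (n (k + N)) (k + N)).1 le_rfl
      have h2 := hw (n (k + N) - N)
      rw [sub_add_cancel] at h2
      push_cast at h1
      have := (hn (n (k + N) - N) k).2 (by linarith)
      linarith
    · have h1 := (hn (n k) k).1 le_rfl
      refine (hn _ _).2 ?_
      rw [hw]; push_cast; linarith
  have hF := sign_sineProd hN hmono hw hn
  have hG : ∀ k, ∀ j ∈ Finset.Ioc (n (k - 1)) (n k),
      (SignType.sign (Real.cos (Real.pi * (w j - j))) : ℝ)
        = if w j = k + 1 / 2 then 0 else (-1) ^ (j + k) := by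
    intro k j hj
    rw [Finset.mem_Ioc] at hj
    refine sign_cos_pi_mul_sub ?_ ((hn _ _).1 hj.2)
    by_contra hcon
    have := (hn j (k - 1)).2 (by push_cast; linarith)
    omega
  -- Strict monotonicity allows at most one tie per block, at its right end; by `htie'` such a block
  -- is nonempty. A tie thus removes one term from the block sum, matching the vanishing of
  -- `sineProd N w k`.
  have htie : ∀ k, ∀ j ∈ Finset.Ioc (n (k - 1)) (n k), w j = k + 1 / 2 → j = n k := by
    intro k j hj h
    refine le_antisymm (Finset.mem_Ioc.1 hj).2 (hmono.le_iff_le.1 ?_)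
    rw [h]; exact (hn _ _).1 le_rfl
  have htie' : ∀ k : ℤ, w (n k) = k + 1 / 2 → n (k - 1) < n k := by
    intro k h
    by_contra hcon
    have := (hn (n k) (k - 1)).1 (by omega)
    rw [h] at this
    push_cast at this
    linarith
  have hcosper : ∀ j : ℤ,
      (SignType.sign (Real.cos (Real.pi * (w (j + N) - ((j + N : ℤ) : ℝ)))) : ℝ)
      = (SignType.sign (Real.cos (Real.pi * (w j - (j : ℝ)))) : ℝ) := by
    intro j
    rw [hw]; push_cast; rw [add_sub_add_right_eq_sub]
  have hblock : ∀ k, ∀ φ : ℤ → ℝ,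
      ∑ j ∈ Finset.Ioc (n (k - 1)) (n k), (if w j = k + 1 / 2 then 0 else φ j)
      = (∑ j ∈ Finset.Ioc (n (k - 1)) (n k), φ j) - if w (n k) = k + 1 / 2 then φ (n k) else 0 := by
    intro k φ
    have : ∀ j ∈ Finset.Ioc (n (k - 1)) (n k), (if w j = k + 1 / 2 then 0 else φ j)
        = φ j - if j = n k then (if w (n k) = k + 1 / 2 then φ (n k) else 0) else 0 := by
      intro j hj
      by_cases h : j = n k
      · rw [h, if_pos rfl]
        split_ifs
        · rw [sub_self]
        · rw [sub_zero]
      · have : ¬ w j = k + 1 / 2 := fun h' => h (htie k j hj h')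
        simp only [this, h, if_false, sub_zero]
    rw [Finset.sum_congr rfl this, Finset.sum_sub_distrib, Finset.sum_ite_eq']
    by_cases h' : w (n k) = k + 1 / 2
    · have := htie' k h'
      simp [this]
    · simp only [if_neg h', ite_self]
  constructor
  · refine sum_range_eq_of_telescope (f := fun k => (SignType.sign (sineProd N w k) : ℝ))
      (g := fun j => (SignType.sign (Real.cos (Real.pi * (w j - (j : ℝ)))) : ℝ))
      (E := fun k => (-1) ^ (n k + k) / 2) hnmono hnN
      (fun k => by rw [sineProd_add_period hw]) hcosper ?_ ?_
    · intro k
      rw [hnN, show n k + N + (k + N) = (n k + k) + (N + N) by ring, zpow_add₀ (by norm_num),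
        (Even.add_self (N : ℤ)).neg_one_zpow, mul_one]
    · intro k
      rw [Finset.sum_congr rfl (hG k), hblock, hF]
      obtain ⟨M, hM⟩ : ∃ M : ℕ, n k = n (k - 1) + M :=
        ⟨(n k - n (k - 1)).toNat, by have := hnmono (show k - 1 ≤ k by omega); omega⟩
      have h1 : ∑ j ∈ Finset.Ioc (n (k - 1)) (n k), (-1 : ℝ) ^ (j + k)
          = ((-1) ^ (n k + k) - (-1) ^ (n (k - 1) + k)) / 2 := by
        have := sum_Ioc_neg_one_zpow (n (k - 1)) M
        rw [← hM, ← Finset.mul_sum] at this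
        simp_rw [zpow_add₀ (show (-1 : ℝ) ≠ 0 by norm_num), ← Finset.sum_mul]
        linear_combination (-1) ^ k / 2 * this
      rw [h1, show n (k - 1) + (k - 1) = n (k - 1) + k - 1 by ring,
        zpow_sub_one₀ (by norm_num) (n (k - 1) + k)]
      split_ifs <;> ring
  · refine sum_range_eq_of_telescope (f := fun k => (SignType.sign (sineProd N w k) : ℝ) ^ 2)
      (g := fun j => (SignType.sign (Real.cos (Real.pi * (w j - (j : ℝ)))) : ℝ) ^ 2)
      (E := fun k => (k : ℝ) - n k) hnmono hnN
      (fun k => by rw [sineProd_add_period hw]) (fun j => by rw [hcosper]) ?_ ?_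
    · intro k
      rw [hnN]; push_cast; ring
    · intro k
      have hsq : ∀ m : ℤ, ((-1 : ℝ) ^ m) ^ 2 = 1 := fun m => by
        rcases Int.even_or_odd m with h | h <;> simp [h.neg_one_zpow]
      have h2 : ∀ j ∈ Finset.Ioc (n (k - 1)) (n k),
          (SignType.sign (Real.cos (Real.pi * (w j - j))) : ℝ) ^ 2
            = if w j = k + 1 / 2 then 0 else 1 := by
        intro j hj
        rw [hG k j hj]
        split_ifs
        · norm_num
        · exact hsq _
      rw [Finset.sum_congr rfl h2, hblock k (fun _ => 1), hF]
      have h3 : ((Finset.Ioc (n (k - 1)) (n k)).card : ℝ) = n k - n (k - 1) := by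
        have := hnmono (show k - 1 ≤ k by omega)
        rw [Int.card_Ioc]
        have h4 : (((n k - n (k - 1)).toNat : ℤ) : ℝ) = ((n k - n (k - 1) : ℤ) : ℝ) := by
          rw [Int.toNat_of_nonneg (by omega)]
        push_cast at h4
        exact h4
      rw [Finset.sum_const, nsmul_eq_mul, h3]
      split_ifs
      · push_cast; ring
      · rw [hsq]; push_cast; ring

/-- Over one period, the signs of `sineProd N w k` and of `cos (π (w k - k))` take each value
equally often. -/
theorem sum_indicator_sign_eq (hN : 0 < N) (hmono : StrictMono w)
    (hw : ∀ j, w (j + N) = w j + N) (s : SignType) :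
    ∑ k ∈ Finset.range N, (if SignType.sign (sineProd N w k) = s then 1 else 0)
      = ∑ k ∈ Finset.range N,
        (if SignType.sign (Real.cos (Real.pi * (w k - ((k : ℤ) : ℝ)))) = s then 1 else 0) := by
  obtain ⟨h1, h2⟩ := sum_sign_eq_sum_sign hN hmono hw
  -- A function on the three points `-1, 0, 1` is a quadratic polynomial, so the first two moments
  -- determine the count of each sign.
  obtain ⟨a, b, c, habc⟩ : ∃ a b c : ℝ, ∀ t : SignType,
      ((if t = s then 1 else 0 : ℕ) : ℝ) = a + b * (t : ℝ) + c * (t : ℝ) ^ 2 := by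
    cases s
    · exact ⟨1, 0, -1, fun t => by cases t <;> simp⟩
    · exact ⟨0, -1 / 2, 1 / 2, fun t => by
        cases t
        · norm_num; decide
        · norm_num
        · norm_num⟩
    · exact ⟨0, 1 / 2, 1 / 2, fun t => by cases t <;> norm_num⟩
  have : ∀ f : ℕ → SignType, ((∑ k ∈ Finset.range N, (if f k = s then 1 else 0) : ℕ) : ℝ)
      = N * a + b * ∑ k ∈ Finset.range N, (f k : ℝ) + c * ∑ k ∈ Finset.range N, (f k : ℝ) ^ 2 := by
    intro f
    rw [Nat.cast_sum]
    simp_rw [habc, Finset.sum_add_distrib, Finset.mul_sum]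
    simp
  have h3 := this fun k => SignType.sign (sineProd N w k)
  rw [h1, h2, ← this] at h3
  exact_mod_cast h3

end

/-! ### Affine labels, rotation and the height sequence -/

section

variable {N h : ℕ}

theorem fundInner_eq (i : Fin N) (j : Fin (N - 1)) :
    fundInner i j = (if (i : ℤ) ≤ (j : ℤ) then 1 else 0) - ((j : ℝ) + 1) / N := by
  have hcard : (Finset.univ.filter fun k : Fin N => k.val ≤ j.val).card = j.val + 1 := by
    have := Fin.card_filter_val_lt (n := N) (m := j.val + 1)
    simp only [Nat.lt_succ_iff] at this
    rw [this]; omega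
  simp only [fundInner, stdInner, Finset.sum_sub_distrib, Finset.sum_ite_eq, Finset.sum_const,
    hcard, Finset.mem_filter, Finset.mem_univ, true_and, Nat.cast_le, nsmul_eq_mul]
  push_cast
  ring

/-- The coordinate `(e_{i+1}, l)`, extended to all integers `i`. -/
noncomputable def coord (l : Weight N h) (i : ℤ) : ℝ :=
  ∑ j : Fin (N - 1), (l.1 j : ℝ) * ((if i ≤ (j : ℤ) then 1 else 0) - ((j : ℝ) + 1) / N)

theorem pairing_eq_coord (i : Fin N) (l : Weight N h) : pairing i l = coord l i := by
  simp only [pairing, fundInner_eq, coord]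

theorem coord_sub_coord_add_one (l : Weight N h) (i : Fin (N - 1)) :
    coord l i - coord l (i + 1) = l.1 i := by
  rw [coord, coord, ← Finset.sum_sub_distrib, Finset.sum_eq_single i]
  · simp [mul_sub]
  · intro j _ hj
    have hj' : (j : ℕ) ≠ i := fun h => hj (Fin.ext h)
    have : ((i : ℤ) ≤ j) ↔ ((i : ℤ) + 1 ≤ j) := by omega
    simp only [this, sub_self]
  · simp

theorem coord_zero_sub_coord_last (l : Weight N h) :
    coord l 0 - coord l (N - 1) = ∑ j, (l.1 j : ℝ) := by
  rw [coord, coord, ← Finset.sum_sub_distrib]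
  refine Finset.sum_congr rfl fun j _ => ?_
  have h1 : (0 : ℤ) ≤ j := by omega
  have h2 : ¬ ((N : ℤ) - 1 ≤ j) := by have := j.2; omega
  rw [if_pos h1, if_neg h2]
  ring

theorem coord_last (l : Weight N h) :
    coord l (N - 1) = -(∑ j : Fin (N - 1), ((j : ℝ) + 1) * l.1 j) / N := by
  rw [coord, neg_div, Finset.sum_div, ← Finset.sum_neg_distrib]
  refine Finset.sum_congr rfl fun j _ => ?_
  have h2 : ¬ ((N : ℤ) - 1 ≤ j) := by have := j.2; omega
  rw [if_neg h2]
  ring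

/-- The weights of the standard representation sum to zero. -/
theorem sum_coord (hN : 0 < N) (l : Weight N h) : ∑ i ∈ Finset.range N, coord l i = 0 := by
  have hN' : (N : ℝ) ≠ 0 := by positivity
  simp only [coord]
  rw [Finset.sum_comm]
  refine Finset.sum_eq_zero fun j _ => ?_
  rw [← Finset.mul_sum, Finset.sum_sub_distrib, Finset.sum_const, Finset.card_range,
    nsmul_eq_mul, mul_div_cancel₀ _ hN', Finset.sum_boole]
  have : (Finset.range N).filter (fun i : ℕ => (i : ℤ) ≤ j) = Finset.range (j + 1) := by
    ext i
    have := j.2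
    simp only [Finset.mem_filter, Finset.mem_range]
    omega
  rw [this, Finset.card_range]
  push_cast
  ring

/-- The labels `λ₁, ..., λ_{N-1}, λ₀` of the affine weight of level `h` attached to a weight. -/
def affineLabel (l : Weight N h) (i : ℕ) : ℕ :=
  if hi : i < N - 1 then l.1 ⟨i, hi⟩ else h - ∑ j, l.1 j

theorem affineLabel_pos (l : Weight N h) (i : ℕ) : 0 < affineLabel l i := by
  unfold affineLabel
  split_ifs with hi
  · exact l.2.1 _
  · have := l.2.2; omega

theorem sum_affineLabel (hN : 0 < N) (l : Weight N h) :
    ∑ i ∈ Finset.range N, affineLabel l i = h := by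
  have h1 : ∑ i ∈ Finset.range (N - 1), affineLabel l i = ∑ j, l.1 j := by
    rw [Finset.sum_range]
    refine Finset.sum_congr rfl fun j _ => ?_
    simp [affineLabel]
  have h2 : affineLabel l (N - 1) = h - ∑ j, l.1 j := by simp [affineLabel]
  have h3 := Finset.sum_range_succ (affineLabel l) (N - 1)
  rw [Nat.sub_add_cancel hN] at h3
  have := l.2.2
  omega

/-- The cyclic rotation of the affine labels of a weight. -/
def rot (hN : 2 ≤ N) (l : Weight N h) : Weight N h :=
  ⟨fun j => affineLabel l (j + 1), fun _ => affineLabel_pos l _, by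
    have h1 := sum_affineLabel (by omega) l
    have h2 := Finset.sum_range_succ' (affineLabel l) (N - 1)
    rw [Nat.sub_add_cancel (by omega), h1, Finset.sum_range] at h2
    have := affineLabel_pos l 0
    dsimp only
    omega⟩

theorem affineLabel_rot (hN : 2 ≤ N) (l : Weight N h) {i : ℕ} (hi : i < N - 1) :
    affineLabel (rot hN l) i = affineLabel l (i + 1) := by
  rw [affineLabel, dif_pos hi]
  rfl

/-- The increasing quasiperiodic sequence `(N + 1) / 2 - (N / h) (e_{m+1}, l)`, `0 ≤ m < N`,
extended to all integers by `height l (m + N) = height l m + N`. -/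
noncomputable def height (l : Weight N h) (m : ℤ) : ℝ :=
  ((N : ℝ) + 1) / 2 - (N : ℝ) / h * coord l (m % N) + N * ((m / N : ℤ) : ℝ)

theorem height_of_lt (l : Weight N h) {i : ℕ} (hi : i < N) :
    height l i = ((N : ℝ) + 1) / 2 - (N : ℝ) / h * coord l i := by
  rw [height, Int.emod_eq_of_lt (by omega) (by omega), Int.ediv_eq_zero_of_lt (by omega) (by omega)]
  simp

theorem height_add_period (hN : 0 < N) (l : Weight N h) (m : ℤ) :
    height l (m + N) = height l m + N := by
  rw [height, height, Int.add_emod_right, Int.add_ediv_of_dvd_right (dvd_refl _),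
    Int.ediv_self (by omega)]
  push_cast
  ring

/-- The affine labels are the gaps of `height`, up to the factor `N / h`. The gap at `i = N - 1`
crosses the period boundary and is the label `λ₀`, because all labels add up to `h`. -/
theorem height_succ_sub (hN : 0 < N) (hh : 0 < h) (l : Weight N h) {i : ℕ} (hi : i < N) :
    height l ((i : ℤ) + 1) - height l i = (N : ℝ) / h * affineLabel l i := by
  have hh' : (h : ℝ) ≠ 0 := by positivity
  by_cases hi' : i < N - 1
  · have h1 := coord_sub_coord_add_one l ⟨i, hi'⟩
    have h2 := height_of_lt l (show i + 1 < N by omega)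
    simp only at h1
    push_cast at h2
    rw [h2, height_of_lt l hi, affineLabel, dif_pos hi', ← h1]
    ring
  · obtain rfl : i = N - 1 := by omega
    have h1 := coord_zero_sub_coord_last l
    have h2 : ((N - 1 : ℕ) : ℤ) + 1 = 0 + N := by omega
    have h3 := height_of_lt l hN
    have h4 := height_of_lt l hi
    have h5 : ((N - 1 : ℕ) : ℤ) = (N : ℤ) - 1 := by omega
    rw [Nat.cast_zero] at h3
    rw [h2, height_add_period hN, h3, h4, affineLabel, dif_neg hi', Nat.cast_sub l.2.2.le, h5]
    push_cast
    rw [← h1]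
    field_simp
    ring

theorem height_quasiperiodic (hN : 0 < N) (l : Weight N h) (i m : ℤ) :
    height l (i + m * N) = height l i + m * N :=
  apply_add_mul_of_quasiperiodic (height_add_period hN l) i m

theorem strictMono_height (hN : 0 < N) (hh : 0 < h) (l : Weight N h) :
    StrictMono (height l) := by
  refine strictMono_int_of_lt_succ fun m => ?_
  have hm0 := Int.emod_nonneg m (show (N : ℤ) ≠ 0 by omega)
  have hm1 := Int.emod_lt_of_pos m (show (0 : ℤ) < N by omega)
  obtain ⟨i, hi⟩ := Int.eq_ofNat_of_zero_le hm0
  have hm : m = i + m / N * N := by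
    have := Int.emod_add_ediv_mul m N
    omega
  have h1 := height_succ_sub hN hh l (show i < N by omega)
  have h2 : (0 : ℝ) < (N : ℝ) / h * affineLabel l i := by
    have := affineLabel_pos l i
    positivity
  rw [hm, add_right_comm, height_quasiperiodic hN, height_quasiperiodic hN]
  linarith

theorem sum_height (hN : 0 < N) (l : Weight N h) :
    ∑ i ∈ Finset.range N, height l i = N * (((N : ℝ) + 1) / 2) := by
  rw [Finset.sum_congr rfl fun i hi => height_of_lt l (Finset.mem_range.1 hi),
    Finset.sum_sub_distrib, ← Finset.mul_sum, sum_coord hN]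
  simp

/-- Rotation shifts the gaps, so the two sequences differ by a constant after an index shift.
Comparing sums over a period shows that the constant is `-1`. -/
theorem height_rot (hN : 2 ≤ N) (hh : 0 < h) (l : Weight N h) (m : ℤ) :
    height (rot hN l) m = height l (m + 1) - 1 := by
  have hN0 : 0 < N := by omega
  have hN' : (N : ℝ) ≠ 0 := by positivity
  have step : ∀ i : ℕ, i < N → height (rot hN l) i - height l (i + 1)
      = height (rot hN l) 0 - height l 1 := by
    intro i
    induction i with
    | zero => simp
    | succ i ih =>
      intro hi
      have h1 := height_succ_sub hN0 hh (rot hN l) (show i < N by omega)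
      rw [affineLabel_rot hN l (by omega)] at h1
      have h2 := height_succ_sub hN0 hh l hi
      have := ih (by omega)
      push_cast at h2 ⊢
      linarith
  -- Both heights have the same sum over `0 ≤ i < N`; shifting the window by one adds `height l N -
  -- height l 0 = N`.
  have hsum : ∑ i ∈ Finset.range N, (height (rot hN l) i - height l (i + 1)) = -N := by
    rw [Finset.sum_sub_distrib, sum_height hN0]
    have h1 := Finset.sum_range_succ (fun i : ℕ => height l i) N
    rw [Finset.sum_range_succ', sum_height hN0] at h1
    have h2 := height_add_period hN0 l 0
    rw [zero_add] at h2
    push_cast at h1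
    rw [h2] at h1
    linarith
  rw [Finset.sum_congr rfl fun i hi => step i (Finset.mem_range.1 hi), Finset.sum_const,
    Finset.card_range, nsmul_eq_mul] at hsum
  have hconst : height (rot hN l) 0 - height l 1 = -1 := by
    apply mul_left_cancel₀ hN'
    linarith
  have hm0 := Int.emod_nonneg m (show (N : ℤ) ≠ 0 by omega)
  have hm1 := Int.emod_lt_of_pos m (show (0 : ℤ) < N by omega)
  obtain ⟨i, hi⟩ := Int.eq_ofNat_of_zero_le hm0
  have hm : m = i + m / N * N := by
    have := Int.emod_add_ediv_mul m N
    omega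
  have := step i (by omega)
  rw [hm, add_right_comm, height_quasiperiodic hN0, height_quasiperiodic hN0]
  linarith

theorem height_injective (hN : 0 < N) (hh : 0 < h) :
    Function.Injective (height : Weight N h → ℤ → ℝ) := by
  intro l l' hl
  have hN' : (N : ℝ) ≠ 0 := by positivity
  have hh' : (h : ℝ) ≠ 0 := by positivity
  apply Subtype.ext
  funext j
  have h1 := height_succ_sub hN hh l (show (j : ℕ) < N by omega)
  have h2 := height_succ_sub hN hh l' (show (j : ℕ) < N by omega)
  rw [hl, h2] at h1
  have h3 := mul_left_cancel₀ (div_ne_zero hN' hh') h1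
  rw [affineLabel, affineLabel, dif_pos j.2, dif_pos j.2] at h3
  exact_mod_cast h3.symm

theorem rot_bijective (hN : 2 ≤ N) (hh : 0 < h) :
    Function.Bijective (rot hN : Weight N h → Weight N h) := by
  refine Function.Injective.bijective_of_finite fun l l' hl => ?_
  refine height_injective (by omega) hh (funext fun m => ?_)
  have h1 := height_rot hN hh l (m - 1)
  have h2 := height_rot hN hh l' (m - 1)
  rw [hl, h2, sub_add_cancel] at h1
  linarith

theorem height_rot_iterate (hN : 2 ≤ N) (hh : 0 < h) (l : Weight N h) (k : ℕ) (m : ℤ) :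
    height ((rot hN)^[k] l) m = height l (m + k) - k := by
  induction k generalizing m with
  | zero => simp
  | succ k ih =>
    rw [Function.iterate_succ_apply', height_rot hN hh, ih]
    push_cast
    rw [show m + 1 + (k : ℤ) = m + (k + 1) by ring]
    ring

/-- Index `-1` is the coordinate of `e_N` moved down one period, and `(e_N, l) = -(1/N) ∑ j l_j` is
the weighted sum in `qR`. The remaining constants combine to `-(N - 1) / 2`. -/
theorem qR_eq_height (hN : 0 < N) (hh : 0 < h) (l : Weight N h) : qR l = height l (-1) := by
  have hN' : (N : ℝ) ≠ 0 := by positivity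
  have hh' : (h : ℝ) ≠ 0 := by positivity
  have h1 := height_quasiperiodic hN l ((N - 1 : ℕ) : ℤ) (-1)
  have h2 : ((N - 1 : ℕ) : ℤ) = (N : ℤ) - 1 := by omega
  have h3 := height_of_lt l (show N - 1 < N by omega)
  rw [h3, h2, show (N : ℤ) - 1 + -1 * N = -1 by ring, coord_last] at h1
  rw [h1, qR]
  have h4 : ∑ j : Fin (N - 1), ((j : ℝ) + 1) = (N : ℝ) * (N - 1) / 2 := by
    rw [Finset.sum_add_distrib, ← Finset.sum_range (fun i : ℕ => (i : ℝ))]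
    have h5 := Finset.sum_range_id_mul_two (N - 1)
    have h6 : (∑ i ∈ Finset.range (N - 1), (i : ℝ)) * 2 = ((N : ℝ) - 1) * (N - 1 - 1) := by
      rcases Nat.lt_or_ge N 2 with h7 | h7
      · obtain rfl : N = 1 := by omega
        simp
      · have := congrArg (Nat.cast : ℕ → ℝ) h5
        push_cast [Nat.cast_sub (show 1 ≤ N - 1 by omega), Nat.cast_sub (show 1 ≤ N by omega)] at this
        exact this
    have h8 : ((N - 1 : ℕ) : ℝ) = N - 1 := by rw [Nat.cast_sub hN, Nat.cast_one]
    simp only [Finset.sum_const, Finset.card_univ, Fintype.card_fin, nsmul_eq_mul, mul_one, h8]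
    linarith
  simp only [mul_sub, mul_one, Finset.sum_sub_distrib, h4]
  field_simp
  push_cast
  ring

/-- The sequence whose points are compared with half-integers in the signature count. -/
noncomputable def spectralPoint (l : Weight N h) (j : ℤ) : ℝ := height l (j - 1)

theorem strictMono_spectralPoint (hN : 0 < N) (hh : 0 < h) (l : Weight N h) :
    StrictMono (spectralPoint l) := fun _ _ hij =>
  strictMono_height hN hh l (by omega)

theorem spectralPoint_add_period (hN : 0 < N) (l : Weight N h) (j : ℤ) :
    spectralPoint l (j + N) = spectralPoint l j + N := by
  rw [spectralPoint, spectralPoint, ← height_add_period hN, add_sub_right_comm]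

theorem spectralPoint_rot_iterate (hN : 2 ≤ N) (hh : 0 < h) (l : Weight N h) (k : ℕ) (j : ℤ) :
    spectralPoint ((rot hN)^[k] l) j = spectralPoint l (j + k) - k := by
  rw [spectralPoint, spectralPoint, height_rot_iterate hN hh, add_sub_right_comm]

theorem qR_rot_iterate (hN : 2 ≤ N) (hh : 0 < h) (l : Weight N h) (k : ℕ) :
    qR ((rot hN)^[k] l) = spectralPoint l k - k := by
  rw [qR_eq_height (by omega) hh, height_rot_iterate hN hh, spectralPoint,
    show -1 + (k : ℤ) = k - 1 by ring]

/-- Rotating `k` times amounts to viewing the same sequence from the half-integer `k + 1/2`. -/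
theorem sineProd_rot_iterate (hN : 2 ≤ N) (hh : 0 < h) (l : Weight N h) (k : ℕ) :
    sineProd N (spectralPoint ((rot hN)^[k] l)) 0 = sineProd N (spectralPoint l) k := by
  refine Finset.prod_congr rfl fun i _ => ?_
  rw [spectralPoint_rot_iterate hN hh, show 0 + 1 + (i : ℤ) + k = k + 1 + i by ring]
  push_cast
  congr 3
  ring

/-- For a rotation-invariant multiplicity, the eigenvalue signs and the signs of `cos (π q)` have
the same distribution. -/
theorem sum_mul_indicator_sign_eq (hN : 2 ≤ N) (hh : 0 < h) (m : Weight N h → ℕ)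
    (hm : ∀ l, m (rot hN l) = m l) (s : SignType) :
    ∑ l, m l * (if SignType.sign (sineProd N (spectralPoint l) 0) = s then 1 else 0)
      = ∑ l, m l * (if SignType.sign (Real.cos (Real.pi * qR l)) = s then 1 else 0) := by
  have hmk : ∀ k l, m ((rot hN)^[k] l) = m l := by
    intro k
    induction k with
    | zero => simp
    | succ k ih => intro l; rw [Function.iterate_succ_apply', hm, ih]
  -- Each iterate of `rot` permutes the weights and preserves `m`, so `F` may be replaced by its sum
  -- over `N` rotates at the cost of a factor `N`.
  have avg : ∀ F : Weight N h → ℕ,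
      N * ∑ l, m l * F l = ∑ l, m l * ∑ k ∈ Finset.range N, F ((rot hN)^[k] l) := by
    intro F
    simp_rw [Finset.mul_sum]
    rw [Finset.sum_comm]
    have : ∀ k ∈ Finset.range N, ∑ l, m l * F ((rot hN)^[k] l) = ∑ l, m l * F l := by
      intro k _
      rw [← Function.Bijective.sum_comp ((rot_bijective hN hh).iterate k) fun l => m l * F l]
      simp_rw [hmk]
    rw [Finset.sum_congr rfl this, Finset.sum_const, Finset.card_range, smul_eq_mul,
      Finset.mul_sum]
  apply Nat.eq_of_mul_eq_mul_left (show 0 < N by omega)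
  rw [avg, avg]
  refine Finset.sum_congr rfl fun l _ => ?_
  congr 1
  simp_rw [sineProd_rot_iterate hN hh, qR_rot_iterate hN hh]
  exact sum_indicator_sign_eq (by omega) (strictMono_spectralPoint (by omega) hh l)
    (spectralPoint_add_period (by omega) l) s

/-! ### Eigenvalues under rotation and as sine products -/

/-- Up to a constant phase, `ε_i` is `exp (2πi height / N)`. The `-1` in `height_rot` becomes the
root of unity, and passing through a full period changes nothing. -/
theorem eps_rot (hN : 2 ≤ N) (hh : 0 < h) (l : Weight N h) :
    eps (rot hN l) = Complex.exp (-(2 * Real.pi * Complex.I / N)) • (eps l ∘ finRotate N) := by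
  have hNC : (N : ℂ) ≠ 0 := by exact_mod_cast (show N ≠ 0 by omega)
  have hhC : (h : ℂ) ≠ 0 := by exact_mod_cast hh.ne'
  have hNR : (N : ℝ) ≠ 0 := by exact_mod_cast (show N ≠ 0 by omega)
  have hhR : (h : ℝ) ≠ 0 := by exact_mod_cast hh.ne'
  have heps : ∀ (l : Weight N h) (i : Fin N), eps l i
      = Complex.exp (2 * Real.pi * Complex.I * (((height l i - ((N : ℝ) + 1) / 2) / N : ℝ) : ℂ)) := by
    intro l i
    rw [eps, pairing_eq_coord, height_of_lt l i.2]
    congr 1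
    have : (((N : ℝ) + 1) / 2 - (N : ℝ) / h * coord l i - ((N : ℝ) + 1) / 2) / N = -coord l i / h := by
      field_simp
      ring
    rw [this]
    push_cast
    ring
  have hrot : ∀ i : Fin N, Complex.exp (2 * Real.pi * Complex.I *
        (((height l (finRotate N i : Fin N) - ((N : ℝ) + 1) / 2) / N : ℝ) : ℂ))
      = Complex.exp (2 * Real.pi * Complex.I *
        (((height l ((i : ℤ) + 1) - ((N : ℝ) + 1) / 2) / N : ℝ) : ℂ)) := by
    intro i
    obtain ⟨M, rfl⟩ : ∃ M, N = M + 1 := ⟨N - 1, by omega⟩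
    rw [finRotate_apply, Fin.val_add_one]
    split_ifs with hi
    · have h1 := height_add_period (by omega) l 0
      have h2 : (i : ℤ) + 1 = 0 + ((M + 1 : ℕ) : ℤ) := by rw [hi]; simp
      rw [h2, h1, Nat.cast_zero]
      have h3 : (height l 0 + ((M + 1 : ℕ) : ℝ) - (((M + 1 : ℕ) : ℝ) + 1) / 2) / ((M + 1 : ℕ) : ℝ)
          = (height l 0 - (((M + 1 : ℕ) : ℝ) + 1) / 2) / ((M + 1 : ℕ) : ℝ) + 1 := by
        field_simp
        ring
      rw [h3, Complex.ofReal_add, mul_add, Complex.exp_add, Complex.ofReal_one, mul_one,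
        Complex.exp_two_pi_mul_I, mul_one]
    · push_cast
      rfl
  funext i
  rw [Pi.smul_apply, Function.comp_apply, heps, heps l, hrot, smul_eq_mul, ← Complex.exp_add,
    height_rot hN hh]
  congr 1
  push_cast
  field_simp
  ring

theorem fundChar_diagonal_comp_perm (p : ℕ) (d : Fin N → ℂ) (σ : Equiv.Perm (Fin N)) :
    fundChar p (Matrix.diagonal (d ∘ σ)) = fundChar p (Matrix.diagonal d) := by
  rw [fundChar_diagonal, fundChar_diagonal]
  refine Finset.sum_nbij' (fun s => s.map σ.toEmbedding) (fun s => s.map σ.symm.toEmbedding)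
    ?_ ?_ ?_ ?_ ?_
  · intro s hs; simpa using hs
  · intro s hs; simpa using hs
  · intro s _; simp [Finset.map_map]
  · intro s _; simp [Finset.map_map]
  · intro s _; simp

theorem gammaEig_rot (hN : 2 ≤ N) (hh : 0 < h) (p : ℕ) (l : Weight N h) :
    gammaEig p (rot hN l) = Complex.exp (-(2 * Real.pi * Complex.I / N)) ^ p * gammaEig p l := by
  rw [gammaEig, eps_rot hN hh, fundChar_diagonal_smul, fundChar_diagonal_comp_perm, gammaEig]

theorem one_add_exp_neg_two_mul (x : ℝ) :
    1 + Complex.exp (-(2 * x * Complex.I))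
      = Complex.exp (-(x * Complex.I)) * ((2 * Real.cos x : ℝ) : ℂ) := by
  push_cast
  rw [Complex.two_cos, mul_add, ← Complex.exp_add, ← Complex.exp_add,
    show -(x * Complex.I) + x * Complex.I = 0 by ring, Complex.exp_zero]
  congr 2
  ring

theorem prod_eps (hN : 0 < N) (l : Weight N h) : ∏ i, eps l i = 1 := by
  simp only [eps]
  rw [← Complex.exp_sum, ← Finset.mul_sum, ← Complex.ofReal_sum]
  simp_rw [pairing_eq_coord]
  have := sum_coord hN l
  rw [Finset.sum_range] at this
  rw [this]
  simp

/-- Each factor is a half-angle phase times `2 cos`. The phases cancel because the coordinates sum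
to zero, and `π/2` minus the angle of the cosine is `π (height - 1/2) / N`. -/
theorem prod_one_add_eps (hN : 0 < N) (hh : 0 < h) (l : Weight N h) :
    ∏ i, (1 + eps l i) = ((2 ^ N * sineProd N (spectralPoint l) 0 : ℝ) : ℂ) := by
  have hNR : (N : ℝ) ≠ 0 := by exact_mod_cast hN.ne'
  have hhR : (h : ℝ) ≠ 0 := by exact_mod_cast hh.ne'
  have h1 : ∀ i : Fin N, 1 + eps l i = Complex.exp (-((Real.pi * coord l i / h : ℝ) * Complex.I))
      * ((2 * Real.cos (Real.pi * coord l i / h) : ℝ) : ℂ) := by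
    intro i
    rw [← one_add_exp_neg_two_mul, eps, pairing_eq_coord]
    congr 2
    push_cast
    ring
  simp_rw [h1]
  rw [Finset.prod_mul_distrib, ← Complex.exp_sum, Finset.sum_neg_distrib, ← Finset.sum_mul,
    ← Complex.ofReal_sum, ← Finset.sum_div, ← Finset.mul_sum, ← Complex.ofReal_prod]
  have h2 := sum_coord hN l
  rw [Finset.sum_range] at h2
  rw [h2]
  simp only [mul_zero, zero_div, Complex.ofReal_zero, zero_mul, neg_zero, Complex.exp_zero, one_mul]
  congr 1
  rw [Finset.prod_mul_distrib, Finset.prod_const, Finset.card_univ, Fintype.card_fin, sineProd,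
    Finset.prod_range]
  congr 1
  refine Finset.prod_congr rfl fun i _ => ?_
  rw [spectralPoint, show (0 : ℤ) + 1 + (i : ℕ) - 1 = (i : ℕ) by ring, height_of_lt l i.2,
    ← Real.sin_pi_div_two_sub]
  congr 1
  push_cast
  field_simp
  ring

/-- The `2` supplies the missing terms `p = 0` and `p = N`, the latter being the determinant, equal
to `1`. -/
theorem two_add_sum_gammaEig (hN : 2 ≤ N) (hh : 0 < h) (l : Weight N h) :
    2 + ∑ p ∈ Finset.Ico 1 N, gammaEig p l
      = ((2 ^ N * sineProd N (spectralPoint l) 0 : ℝ) : ℂ) := by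
  rw [← prod_one_add_eps (by omega) hh, ← sum_fundChar_diagonal, Finset.sum_range_succ,
    Finset.range_eq_Ico, Finset.sum_eq_sum_Ico_succ_bot (a := 0) (by omega),
    fundChar_zero_diagonal,
    fundChar_top_diagonal, prod_eps (by omega)]
  simp only [gammaEig, zero_add]
  ring

end

/-! ### Signature of a symmetric matrix from a complex eigenbasis -/

section

variable {V : Type*} [Fintype V] [DecidableEq V]

-- An orthonormal eigenbasis is also orthogonal for the form, with the eigenvalues as diagonal
-- values.
open QuadraticMap in
theorem equivalent_weightedSumSquares_eigenvalues {A : Matrix V V ℝ} (hA : A.IsHermitian) :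
    (Matrix.toBilin' A).toQuadraticMap.Equivalent (weightedSumSquares ℝ hA.eigenvalues) := by
  set b : Module.Basis V ℝ (V → ℝ) :=
    hA.eigenvectorBasis.toBasis.map (WithLp.linearEquiv 2 ℝ (V → ℝ)) with hb
  have hbi : ∀ i, b i = ⇑(hA.eigenvectorBasis i) := fun i => by simp [hb]
  have horth : ∀ i j, b i ⬝ᵥ b j = if i = j then 1 else 0 := by
    intro i j
    have := orthonormal_iff_ite.1 hA.eigenvectorBasis.orthonormal j i
    rw [EuclideanSpace.inner_eq_star_dotProduct] at this
    simp only [star_trivial] at this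
    rw [hbi, hbi]
    simpa [eq_comm] using this
  have hQ : ∀ x, (Matrix.toBilin' A).toQuadraticMap (∑ i, x i • b i)
      = weightedSumSquares ℝ hA.eigenvalues x := by
    intro x
    rw [LinearMap.BilinMap.toQuadraticMap_apply, Matrix.toBilin'_apply', Matrix.mulVec_sum]
    have : ∀ i, A *ᵥ (x i • b i) = (hA.eigenvalues i * x i) • b i := by
      intro i
      rw [Matrix.mulVec_smul, hbi, hA.mulVec_eigenvectorBasis, smul_smul, mul_comm]
    simp_rw [this, sum_dotProduct, dotProduct_sum, smul_dotProduct, dotProduct_smul, horth]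
    simp [weightedSumSquares_apply, mul_left_comm]
  refine ⟨((Matrix.toBilin' A).toQuadraticMap.isometryEquivBasisRepr b).trans ?_⟩
  have : (Matrix.toBilin' A).toQuadraticMap.basisRepr b = weightedSumSquares ℝ hA.eigenvalues := by
    ext x
    rw [basisRepr_apply, hQ]
  rw [this]
  exact QuadraticMap.IsometryEquiv.refl _

theorem hasSignature_of_isHermitian {A : Matrix V V ℝ} (hA : A.IsHermitian) :
    HasSignature (Matrix.toBilin' A) {i | 0 < hA.eigenvalues i}.ncard
      {i | hA.eigenvalues i < 0}.ncard {i | hA.eigenvalues i = 0}.ncard := by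
  have hE := equivalent_weightedSumSquares_eigenvalues hA
  have hpos := QuadraticForm.sigPos_of_equiv_weightedSumSquares hE
  have hneg := QuadraticForm.sigNeg_of_equiv_weightedSumSquares hE
  refine ⟨hpos, hneg, ?_⟩
  have h1 : LinearMap.ker (Matrix.toBilin' A) = LinearMap.ker (Matrix.mulVecLin A) := by
    have hAt : Aᵀ = A := by simpa using hA.eq
    have key : ∀ x y, Matrix.toBilin' A x y = A *ᵥ x ⬝ᵥ y := fun x y => by
      rw [Matrix.toBilin'_apply', Matrix.dotProduct_mulVec, ← Matrix.mulVec_transpose, hAt]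
    ext x
    rw [LinearMap.mem_ker, LinearMap.mem_ker, Matrix.mulVecLin_apply, ← dotProduct_eq_zero_iff]
    simp_rw [← key]
    exact ⟨fun hx y => by rw [hx, LinearMap.zero_apply], fun hx => LinearMap.ext hx⟩
  rw [h1]
  have h2 := hA.rank_eq_card_non_zero_eigs
  have h3 := LinearMap.finrank_range_add_finrank_ker A.mulVecLin
  rw [← Matrix.rank, h2, Module.finrank_fintype_fun_eq_card] at h3
  have h4 := Fintype.card_subtype_compl (fun i => hA.eigenvalues i = 0)
  have h5 := Fintype.card_subtype_le (fun i => hA.eigenvalues i = 0)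
  rw [← Nat.card_coe_set_eq, Nat.card_eq_fintype_card]
  change _ = Fintype.card {i // hA.eigenvalues i = 0}
  change Fintype.card {i // ¬ hA.eigenvalues i = 0} + _ = _ at h3
  omega

-- Both families list the roots of the same characteristic polynomial, so they agree as multisets.
-- This carries counts from the complex basis indexed by exponents to the real spectral theorem.
open Polynomial in
theorem card_eigenvalues_eq {A : Matrix V V ℝ} (hA : A.IsHermitian) {ι : Type*} [Fintype ι]
    (b : Module.Basis ι ℂ (EuclideanSpace ℂ V)) (μ : ι → ℝ)
    (hb : ∀ i, Matrix.toEuclideanLin (A.map Complex.ofReal) (b i) = (μ i : ℂ) • b i)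
    (P : ℝ → Prop) :
    {i | P (hA.eigenvalues i)}.ncard = Nat.card {i // P (μ i)} := by
  classical
  have h1 : (A.map Complex.ofReal).charpoly = ∏ i, (X - C (hA.eigenvalues i : ℂ)) := by
    have := Matrix.charpoly_map A Complex.ofRealHom
    rw [hA.charpoly_eq, Polynomial.map_prod] at this
    simp only [Polynomial.map_sub, map_X, map_C] at this
    exact this
  have h2 : (A.map Complex.ofReal).charpoly = ∏ i, (X - C (μ i : ℂ)) := by
    have h3 : LinearMap.toMatrix b b (Matrix.toEuclideanLin (A.map Complex.ofReal))
        = Matrix.diagonal fun i => (μ i : ℂ) := by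
      ext i j
      rw [LinearMap.toMatrix_apply, hb, map_smul, Module.Basis.repr_self, Finsupp.smul_single,
        smul_eq_mul, mul_one, Finsupp.single_apply, Matrix.diagonal_apply]
      split_ifs with h4 h5 h5 <;> simp_all
    rw [← Matrix.charpoly_diagonal, ← h3, LinearMap.charpoly_toMatrix,
      Matrix.toEuclideanLin_eq_toLin_orthonormal, Matrix.charpoly_toLin]
  have h3 : Multiset.map (fun i => (hA.eigenvalues i : ℂ)) Finset.univ.val
      = Multiset.map (fun i => (μ i : ℂ)) Finset.univ.val := by
    have := congrArg Polynomial.roots (h1.symm.trans h2)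
    rwa [Polynomial.roots_prod _ _ (Finset.prod_ne_zero_iff.2 fun _ _ => X_sub_C_ne_zero _),
      Polynomial.roots_prod _ _ (Finset.prod_ne_zero_iff.2 fun _ _ => X_sub_C_ne_zero _),
      Multiset.bind_congr fun _ _ => roots_X_sub_C _, Multiset.bind_congr fun _ _ => roots_X_sub_C _,
      Multiset.bind_singleton, Multiset.bind_singleton] at this
  have h4 : Multiset.map hA.eigenvalues Finset.univ.val = Multiset.map μ Finset.univ.val := by
    apply Multiset.map_injective Complex.ofReal_injective
    simpa [Multiset.map_map, Function.comp_def] using h3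
  have h5 := congrArg (Multiset.countP P) h4
  rw [Multiset.countP_map, Multiset.countP_map] at h5
  rw [← Nat.card_coe_set_eq, Nat.card_eq_fintype_card, Nat.card_eq_fintype_card,
    Fintype.card_subtype fun i => P (μ i)]
  change Fintype.card {i // P (hA.eigenvalues i)} = _
  rw [Fintype.card_subtype]
  exact h5

theorem hasSignature_of_eigenbasis {A : Matrix V V ℝ} (hA : A.IsSymm) {ι : Type*} [Fintype ι]
    (b : Module.Basis ι ℂ (EuclideanSpace ℂ V)) (μ : ι → ℝ)
    (hb : ∀ i, Matrix.toEuclideanLin (A.map Complex.ofReal) (b i) = (μ i : ℂ) • b i) :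
    HasSignature (Matrix.toBilin' A) (Nat.card {i // 0 < μ i}) (Nat.card {i // μ i < 0})
      (Nat.card {i // μ i = 0}) := by
  have hA' : A.IsHermitian := by
    rwa [Matrix.IsHermitian, Matrix.conjTranspose_eq_transpose_of_trivial]
  have := hasSignature_of_isHermitian hA'
  rwa [card_eigenvalues_eq hA' b μ hb (fun x => 0 < x),
    card_eigenvalues_eq hA' b μ hb (fun x => x < 0),
    card_eigenvalues_eq hA' b μ hb (fun x => x = 0)] at this

end

/-! ### The grading symmetry and the final count -/

section

variable {N h : ℕ} {V : Type*} [Fintype V] [DecidableEq V]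

/-- The diagonal operator multiplying the coordinate at `a` by `exp (-2π𝐢 τ(a) / N)`. -/
noncomputable def gradingEquiv [NeZero N] (tau : V → ZMod N) :
    EuclideanSpace ℂ V ≃ₗ[ℂ] EuclideanSpace ℂ V where
  toFun x := WithLp.toLp 2 fun a => ZMod.stdAddChar (-tau a) * x a
  invFun x := WithLp.toLp 2 fun a => ZMod.stdAddChar (tau a) * x a
  map_add' x y := by ext a; simp [mul_add]
  map_smul' c x := by ext a; simp [mul_left_comm]
  left_inv x := by
    ext a
    simp [← mul_assoc, ← AddChar.map_add_eq_mul]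
  right_inv x := by
    ext a
    simp [← mul_assoc, ← AddChar.map_add_eq_mul]

theorem op_apply (A : Matrix V V ℕ) (x : EuclideanSpace ℂ V) (a : V) :
    op A x a = ∑ b, (A a b : ℂ) * x b := by
  simp [op, Matrix.mulVec, dotProduct]

/-- A nonzero entry of `G_p` raises the grading by `p`, so commuting past the grading operator gives
the `p`-th power of `exp (-2πi / N)`. -/
theorem op_gradingEquiv [NeZero N] (Γ : ClassIIGraph N h V) {p : ℕ} (hp : p ∈ Finset.Ico 1 N)
    (x : EuclideanSpace ℂ V) :
    op (Γ.G p) (gradingEquiv Γ.tau x)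
      = Complex.exp (-(2 * Real.pi * Complex.I / N)) ^ p • gradingEquiv Γ.tau (op (Γ.G p) x) := by
  have hchar : ZMod.stdAddChar (-(p : ZMod N))
      = Complex.exp (-(2 * Real.pi * Complex.I / N)) ^ p := by
    have h1 := ZMod.stdAddChar_coe (N := N) (-(p : ℤ))
    push_cast at h1
    rw [h1, ← Complex.exp_nat_mul]
    congr 1
    ring
  ext a
  rw [op_apply, PiLp.smul_apply, ← hchar]
  change ∑ b, (Γ.G p a b : ℂ) * (ZMod.stdAddChar (-Γ.tau b) * x b)
    = ZMod.stdAddChar (-(p : ZMod N)) * (ZMod.stdAddChar (-Γ.tau a) * op (Γ.G p) x a)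
  rw [op_apply, Finset.mul_sum, Finset.mul_sum]
  refine Finset.sum_congr rfl fun b _ => ?_
  by_cases hb : Γ.tau b = Γ.tau a + p
  · rw [hb, neg_add, AddChar.map_add_eq_mul]
    ring
  · simp [Γ.grading p hp a b hb]

/-- The grading operator twists `G_p` by the same factor by which rotation twists `γ_p`, so it
carries the joint eigenspace of `l` onto that of its rotate. -/
theorem mult_rot (hN : 2 ≤ N) (hh : 0 < h) (Γ : ClassIIGraph N h V) (l : Weight N h) :
    mult Γ.G (rot hN l) = mult Γ.G l := by
  have : NeZero N := ⟨by omega⟩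
  set T := gradingEquiv Γ.tau with hT
  have hcomap : (⨅ p ∈ Finset.Ico 1 N, Module.End.eigenspace (op (Γ.G p)) (gammaEig p l))
      = (⨅ p ∈ Finset.Ico 1 N,
          Module.End.eigenspace (op (Γ.G p)) (gammaEig p (rot hN l))).comap
            (T : EuclideanSpace ℂ V →ₗ[ℂ] EuclideanSpace ℂ V) := by
    ext x
    simp only [Submodule.mem_comap, Submodule.mem_iInf, Module.End.mem_eigenspace_iff,
      LinearEquiv.coe_coe]
    refine forall_congr' fun p => forall_congr' fun hp => ?_
    rw [hT, op_gradingEquiv Γ hp, gammaEig_rot hN hh, mul_smul,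
      (smul_right_injective _ (pow_ne_zero p (Complex.exp_ne_zero _))).eq_iff, ← map_smul,
      (gradingEquiv Γ.tau).injective.eq_iff]
  rw [mult, mult, hcomap, Submodule.comap_equiv_eq_map_symm, LinearEquiv.finrank_map_eq]

theorem toEuclideanLin_gMatrix (Γ : ClassIIGraph N h V) :
    Matrix.toEuclideanLin (Γ.gMatrix.map Complex.ofReal)
      = 2 • LinearMap.id + ∑ p ∈ Finset.Ico 1 N, op (Γ.G p) := by
  have : Γ.gMatrix.map Complex.ofReal
      = 2 • (1 : Matrix V V ℂ) + ∑ p ∈ Finset.Ico 1 N, (Γ.G p).map (Nat.cast : ℕ → ℂ) := by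
    ext a b
    rw [ClassIIGraph.gMatrix, Matrix.map_apply, two_nsmul, two_nsmul]
    by_cases hab : a = b <;> simp [Matrix.sum_apply, hab]
  rw [this, map_add, map_nsmul, map_sum]
  congr 2
  ext x a
  simp

theorem card_exponents (G : ℕ → Matrix V V ℕ) (P : Weight N h → Prop) [DecidablePred P] :
    Nat.card {e : Exponents N h G // P e.1} = ∑ l, mult G l * (if P l then 1 else 0) := by
  classical
  rw [Nat.card_eq_fintype_card, Fintype.card_subtype, Finset.card_filter,
    Fintype.sum_sigma]
  refine Finset.sum_congr rfl fun l _ => ?_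
  by_cases hl : P l <;> simp [hl]

theorem sign_cos_pi_mul_of_mem_Ioo {q : ℝ} {k : ℤ}
    (hq : q ∈ Set.Ioo ((k : ℝ) - 1 / 2) (k + 1 / 2)) :
    (SignType.sign (Real.cos (Real.pi * q)) : ℝ) = (-1) ^ k := by
  have := sign_cos_pi_mul_sub (j := 0) hq.1 hq.2.le
  rwa [if_neg hq.2.ne, Int.cast_zero, sub_zero, zero_add] at this

theorem cos_pi_mul_trichotomy (q : ℝ) :
    (SignType.sign (Real.cos (Real.pi * q)) = 1 ↔
      ∃ p : ℤ, q ∈ Set.Ioo (2 * (p : ℝ) - 1 / 2) (2 * (p : ℝ) + 1 / 2)) ∧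
    (SignType.sign (Real.cos (Real.pi * q)) = -1 ↔
      ∃ p : ℤ, q ∈ Set.Ioo (2 * (p : ℝ) + 1 / 2) (2 * (p : ℝ) + 3 / 2)) ∧
    (SignType.sign (Real.cos (Real.pi * q)) = 0 ↔ ∃ p : ℤ, q = (p : ℝ) + 1 / 2) := by
  have hpos : (∃ p : ℤ, q ∈ Set.Ioo (2 * (p : ℝ) - 1 / 2) (2 * (p : ℝ) + 1 / 2)) →
      SignType.sign (Real.cos (Real.pi * q)) = 1 := by
    rintro ⟨p, hp⟩
    have := sign_cos_pi_mul_of_mem_Ioo (k := 2 * p) (q := q) (by push_cast; exact hp)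
    rw [(even_two_mul p).neg_one_zpow] at this
    generalize SignType.sign (Real.cos (Real.pi * q)) = s at this
    cases s <;> first | rfl | norm_num at this
  have hneg : (∃ p : ℤ, q ∈ Set.Ioo (2 * (p : ℝ) + 1 / 2) (2 * (p : ℝ) + 3 / 2)) →
      SignType.sign (Real.cos (Real.pi * q)) = -1 := by
    rintro ⟨p, hp⟩
    have := sign_cos_pi_mul_of_mem_Ioo (k := 2 * p + 1) (q := q) (by
      push_cast; exact ⟨by linarith [hp.1], by linarith [hp.2]⟩)
    rw [(odd_two_mul_add_one p).neg_one_zpow] at this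
    generalize SignType.sign (Real.cos (Real.pi * q)) = s at this
    cases s <;> first | rfl | norm_num at this
  have hzero : (∃ p : ℤ, q = (p : ℝ) + 1 / 2) →
      SignType.sign (Real.cos (Real.pi * q)) = 0 := by
    rintro ⟨p, hp⟩
    have := sign_cos_pi_mul_sub (x := q) (j := 0) (k := p) (by linarith) hp.le
    rw [if_pos hp, Int.cast_zero, sub_zero] at this
    generalize SignType.sign (Real.cos (Real.pi * q)) = s at this
    cases s <;> first | rfl | norm_num at this
  have hcases : (∃ p : ℤ, q ∈ Set.Ioo (2 * (p : ℝ) - 1 / 2) (2 * (p : ℝ) + 1 / 2)) ∨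
      (∃ p : ℤ, q ∈ Set.Ioo (2 * (p : ℝ) + 1 / 2) (2 * (p : ℝ) + 3 / 2)) ∨
      ∃ p : ℤ, q = (p : ℝ) + 1 / 2 := by
    -- Here `k` is the integer nearest to `q`: equality in `h1` is the half-integer case, and
    -- otherwise the parity of `k` selects the interval.
    have h1 := Int.floor_le (q + 1 / 2)
    have h2 := Int.lt_floor_add_one (q + 1 / 2)
    set k := ⌊q + 1 / 2⌋
    rcases h1.eq_or_lt with h3 | h3
    · exact Or.inr (Or.inr ⟨k - 1, by push_cast; linarith⟩)
    · rcases Int.even_or_odd' k with ⟨p, hp | hp⟩ <;> rw [hp] at h2 h3 <;> push_cast at h2 h3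
      · exact Or.inl ⟨p, by linarith, by linarith⟩
      · exact Or.inr (Or.inl ⟨p, by linarith, by linarith⟩)
  -- The three conditions are exhaustive and force distinct signs, which gives the converses.
  refine ⟨⟨fun hs => ?_, hpos⟩, ⟨fun hs => ?_, hneg⟩, ⟨fun hs => ?_, hzero⟩⟩ <;>
    rcases hcases with hc | hc | hc <;> first
      | exact hc
      | (have := hpos hc; rw [hs] at this; exact absurd this (by decide))
      | (have := hneg hc; rw [hs] at this; exact absurd this (by decide))
      | (have := hzero hc; rw [hs] at this; exact absurd this (by decide))

theorem hasSignature_intersectionForm (hN : 2 ≤ N) (hh : 0 < h) (Γ : ClassIIGraph N h V) :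
    HasSignature Γ.intersectionForm
      (Nat.card {e : Γ.Exp // SignType.sign (sineProd N (spectralPoint e.1) 0) = 1})
      (Nat.card {e : Γ.Exp // SignType.sign (sineProd N (spectralPoint e.1) 0) = -1})
      (Nat.card {e : Γ.Exp // SignType.sign (sineProd N (spectralPoint e.1) 0) = 0}) := by
  obtain ⟨psi, hpsi⟩ := Γ.exists_eigenbasis
  have hpow : (0 : ℝ) < 2 ^ N := by positivity
  have hlt : ∀ x : ℝ, 2 ^ N * x < 0 ↔ x < 0 := fun x => by
    constructor <;> intro hx <;> nlinarith
  have := hasSignature_of_eigenbasis Γ.gMatrix_isSymm psi.toBasis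
    (fun e : Γ.Exp => 2 ^ N * sineProd N (spectralPoint e.1) 0) (by
      intro e
      rw [toEuclideanLin_gMatrix, OrthonormalBasis.coe_toBasis, ← two_add_sum_gammaEig hN hh,
        LinearMap.add_apply, LinearMap.sum_apply, Finset.sum_congr rfl (hpsi e), add_smul,
        Finset.sum_smul]
      simp [two_smul])
  simpa only [mul_pos_iff_of_pos_left hpow, hlt, mul_eq_zero, hpow.ne',
    false_or, sign_eq_one_iff, sign_eq_neg_one_iff, sign_eq_zero_iff,
    ClassIIGraph.intersectionForm] using this

theorem card_exponents_sign_eq (hN : 2 ≤ N) (hh : 0 < h) (Γ : ClassIIGraph N h V)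
    (s : SignType) {P : ℝ → Prop}
    (hP : ∀ q, SignType.sign (Real.cos (Real.pi * q)) = s ↔ P q) :
    Nat.card {e : Γ.Exp // SignType.sign (sineProd N (spectralPoint e.1) 0) = s}
      = Nat.card {e : Γ.Exp // P (qR e.1)} := by
  classical
  simp_rw [← hP]
  rw [card_exponents Γ.G fun l => SignType.sign (sineProd N (spectralPoint l) 0) = s,
    card_exponents Γ.G fun l => SignType.sign (Real.cos (Real.pi * qR l)) = s]
  exact sum_mul_indicator_sign_eq hN hh _ (mult_rot hN hh Γ) s

end

end Zuber

theorem corollary1 {N h : ℕ} (hN : 2 ≤ N) (hh : N < h) {V : Type*} [Fintype V] [DecidableEq V]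
    (Γ : Zuber.ClassIIGraph N h V) :
    Zuber.HasSignature Γ.intersectionForm
      (Nat.card {e : Γ.Exp // ∃ p : ℤ,
        Zuber.qR e.1 ∈ Set.Ioo (2 * (p : ℝ) - 1 / 2) (2 * (p : ℝ) + 1 / 2)})
      (Nat.card {e : Γ.Exp // ∃ p : ℤ,
        Zuber.qR e.1 ∈ Set.Ioo (2 * (p : ℝ) + 1 / 2) (2 * (p : ℝ) + 3 / 2)})
      (Nat.card {e : Γ.Exp // ∃ p : ℤ, Zuber.qR e.1 = (p : ℝ) + 1 / 2}) := by
  have hh0 : 0 < h := by omega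
  have := Zuber.hasSignature_intersectionForm hN hh0 Γ
  rwa [Zuber.card_exponents_sign_eq hN hh0 Γ 1 fun q => (Zuber.cos_pi_mul_trichotomy q).1,
    Zuber.card_exponents_sign_eq hN hh0 Γ (-1) fun q => (Zuber.cos_pi_mul_trichotomy q).2.1,
    Zuber.card_exponents_sign_eq hN hh0 Γ 0 fun q => (Zuber.cos_pi_mul_trichotomy q).2.2] at this
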